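/- **Setting.** An arena $\mathcal A=(V_0,V_1,E,\mathbb U,\lambda)$ consists of disjoint sets $V_0,V_1$ (the vertices of Player $0$ and of Player $1$) whose union $V$ is finite and non-empty, a set $E\subseteq V\times V$ of edges such that every vertex has an outgoing edge, and an edge labelling $\lambda:E\to\mathbb U$, extended to sequences of edges letter by letter. A play is an infinite path in $(V,E)$. A game is a pair $(\mathcal A,O)$ where $O$ is a set of plays; Player $0$ wins the plays in $O$, and Player $1$ wins all other plays. A strategy for Player $i$ is a function $S:V^*V_i\to V$ with $(v,S(uv))\in E$ for all $u\in V^*$, $v\in V_i$; it is memoryless if $S(uv)$ depends only on $v$. A play $\pi$ is consistent with $S$ if $\pi_{j+1}=S(\pi_0\cdots\pi_j)$ whenever $\pi_j\in V_i$. A strategy for Player $i$ is winning from $v$ if Player $i$ wins every play that starts at $v$ and is consistent with it. The winning region of Player $i$ is the set of vertices from which Player $i$ has a winning strategy. A game is determined if the two winning regions partition $V$ (one of them may be empty). It is pointwise memoryless determined if it is determined and each player has, from each vertex of their winning region, a memoryless strategy winning from that vertex. It is uniform memoryless determined if it is determined and each player has a single memoryless strategy that is winning from every vertex of their winning region. The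 cycles-decomposition $\mathrm{cycles}(\pi)$ of a play $\pi$ is the sequence of cycles output by the following algorithm. Start with an empty stack. At step $j=0,1,2,\dots$ push the edge $(\pi_j,\pi_{j+1})$; if for some $k\ge 1$ the top $k$ edges of the stack form a cycle $(v_1,v_2)(v_2,v_3)\cdots(v_k,v_1)$, pop this cycle and output it. Let $Y\subseteq\mathbb U^*$ and $\neg Y=\mathbb U^*\setminus Y$. Let $O_{\mathrm{AC}(Y)}$ be the set of plays $\pi$ such that $\lambda(u)\in Y$ for all cycles $u$ in $\mathrm{cycles}(\pi)$, and let $O_{\mathrm{EAC}(Y)}$ be the set of plays that have some suffix $\pi'$ such that $\lambda(u)\in Y$ for all cycles $u$ in $\mathrm{cycles}(\pi')$. The games $(\mathcal A,O_{\mathrm{AC}(Y)})$ and $(\mathcal A,O_{\mathrm{EAC}(Y)})$ are the all-cycles game and the suffix all-cycles game of $Y$ on $\mathcal A$. A game $(\mathcal A,O)$ is $Y$-greedy if $O_{\mathrm{AC}(Y)}\subseteq O$ and $O_{\mathrm{AC}(\neg Y)}\cap O=\emptyset$. The arena $\mathcal A$ is $Y$-unambiguous if $O_{\mathrm{EAC}(Y)}\cap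 O_{\mathrm{EAC}(\neg Y)}=\emptyset$. The set $Y$ is closed under cyclic permutations if $ab\in Y$ implies $ba\in Y$ for all $a\in\mathbb U$, $b\in\mathbb U^*$. **Corollary.** Suppose that the arena $\mathcal A$ is $Y$-unambiguous. Then: 1. every $Y$-greedy game $(\mathcal A,O)$ is pointwise memoryless determined; 2. the games $(\mathcal A,O_{\mathrm{EAC}(Y)})$ and $(\mathcal A,O_{\mathrm{AC}(Y)})$ are pointwise memoryless determined. If in addition $Y$ is closed under cyclic permutations, then all the games in 1 and 2 are uniform memoryless determined. -/

import Mathlib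

/-- An arena with vertex set `V` and label set `U`. The function `owner` gives the partition of
the vertices into `V₀ = {v | owner v = 0}` and `V₁ = {v | owner v = 1}` (one of them may be empty).
The labelling is a total function of two vertices, but only its values on edges are ever used. -/
structure Arena (V : Type*) (U : Type*) where
  owner : V → Fin 2
  edge : V → V → Prop
  noDeadEnd : ∀ v, ∃ w, edge v w
  label : V → V → U

/-- A sequence of edges `(v₁,v₂) (v₂,v₃) ⋯ (vₖ,v₁)` with `k ≥ 1`. -/
def IsCycle {V : Type*} : List (V × V) → Prop
  | [] => False
  | e :: t => List.IsChain (fun a b : V × V => a.2 = b.1) (e :: t) ∧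
      ((e :: t).getLast (List.cons_ne_nil e t)).2 = e.1

open Classical in
/-- Given a stack of edges (top of the stack first), look for a number `k` such that the top `k`
edges, read in the order in which they were pushed, form a cycle. If there is one, pop this cycle
and output it. The result is the new stack together with the output, if any. -/
noncomputable def popCycle {V : Type*} (st : List (V × V)) :
    List (V × V) × Option (List (V × V)) :=
  if h : ∃ k, IsCycle (st.take k).reverse then
    (st.drop (Nat.find h), some (st.take (Nat.find h)).reverse)
  else (st, none)

/-- The stack just before step `j` of the algorithm processing `π`. -/
noncomputable def stackAt {V : Type*} (π : ℕ → V) : ℕ → List (V × V)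
  | 0 => []
  | j + 1 => (popCycle ((π j, π (j + 1)) :: stackAt π j)).1

/-- The output of step `j` of the algorithm processing `π`: push the edge `(π j, π (j + 1))`, and
pop and output the cycle at the top of the stack, if there is one. -/
noncomputable def outputAt {V : Type*} (π : ℕ → V) (j : ℕ) : Option (List (V × V)) :=
  (popCycle ((π j, π (j + 1)) :: stackAt π j)).2

/-- The cycles that occur in the cycles-decomposition of `π`. -/
def cycles {V : Type*} (π : ℕ → V) : Set (List (V × V)) :=
  {u | ∃ j, outputAt π j = some u}

/-- The cycle property `Y` is closed under cyclic permutations. -/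
def ClosedUnderCyclicPermutations {U : Type*} (Y : Set (List U)) : Prop :=
  ∀ (a : U) (b : List U), a :: b ∈ Y → b ++ [a] ∈ Y

namespace Arena

/-- The infinite paths in the arena. -/
def plays {V U : Type*} (A : Arena V U) : Set (ℕ → V) :=
  {π | ∀ j, A.edge (π j) (π (j + 1))}

/-- The string of labels of a finite sequence of edges. -/
def labels {V U : Type*} (A : Arena V U) (u : List (V × V)) : List U :=
  u.map fun e => A.label e.1 e.2

/-- The objective of the all-cycles game of `Y`. -/
def allCycles {V U : Type*} (A : Arena V U) (Y : Set (List U)) : Set (ℕ → V) :=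
  {π | π ∈ A.plays ∧ ∀ u ∈ cycles π, A.labels u ∈ Y}

/-- The objective of the suffix all-cycles game of `Y`. -/
def suffixAllCycles {V U : Type*} (A : Arena V U) (Y : Set (List U)) : Set (ℕ → V) :=
  {π | π ∈ A.plays ∧ ∃ n : ℕ, ∀ u ∈ cycles (fun j => π (n + j)), A.labels u ∈ Y}

/-- The game `(A, O)` is `Y`-greedy. -/
def IsGreedy {V U : Type*} (A : Arena V U) (Y : Set (List U)) (O : Set (ℕ → V)) : Prop :=
  A.allCycles Y ⊆ O ∧ A.allCycles Yᶜ ⊆ Oᶜ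

/-- The arena `A` is `Y`-unambiguous. -/
def IsUnambiguous {V U : Type*} (A : Arena V U) (Y : Set (List U)) : Prop :=
  A.suffixAllCycles Y ∩ A.suffixAllCycles Yᶜ = ∅

/-- `S` is a strategy for Player `i`: for a history `u v` ending in a vertex `v` of Player `i`, the
move is `S u v`, and it follows an edge. (Values of `S u v` for other vertices `v` are never
used.) -/
def IsStrategy {V U : Type*} (A : Arena V U) (i : Fin 2) (S : List V → V → V) : Prop :=
  ∀ (u : List V) (v : V), A.owner v = i → A.edge v (S u v)

/-- The move of `S` depends only on the last vertex of the history. -/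
def IsMemoryless {V U : Type*} (A : Arena V U) (i : Fin 2) (S : List V → V → V) : Prop :=
  ∀ (u u' : List V) (v : V), A.owner v = i → S u v = S u' v

/-- The play `π` is consistent with the strategy `S` for Player `i`. -/
def IsConsistent {V U : Type*} (A : Arena V U) (i : Fin 2) (S : List V → V → V) (π : ℕ → V) :
    Prop :=
  ∀ j, A.owner (π j) = i → π (j + 1) = S ((List.range j).map π) (π j)

end Arena

/-- In a game with objective `O`, the play `π` is won by Player `i`. -/
def WonBy {V : Type*} (O : Set (ℕ → V)) (i : Fin 2) (π : ℕ → V) : Prop :=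
  if i = 0 then π ∈ O else π ∉ O

namespace Arena

/-- The strategy `S` for Player `i` is winning from `v` in the game `(A, O)`. -/
def IsWinningFrom {V U : Type*} (A : Arena V U) (O : Set (ℕ → V)) (i : Fin 2)
    (S : List V → V → V) (v : V) : Prop :=
  ∀ π ∈ A.plays, π 0 = v → A.IsConsistent i S π → WonBy O i π

/-- The winning region of Player `i` in the game `(A, O)`. -/
def winningRegion {V U : Type*} (A : Arena V U) (O : Set (ℕ → V)) (i : Fin 2) : Set V :=
  {v | ∃ S, A.IsStrategy i S ∧ A.IsWinningFrom O i S v}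

/-- The memoryless winning region of Player `i` in the game `(A, O)`. -/
def memorylessWinningRegion {V U : Type*} (A : Arena V U) (O : Set (ℕ → V)) (i : Fin 2) : Set V :=
  {v | ∃ S, A.IsStrategy i S ∧ A.IsMemoryless i S ∧ A.IsWinningFrom O i S v}

/-- The winning regions of the two players partition the set of vertices. -/
def IsDetermined {V U : Type*} (A : Arena V U) (O : Set (ℕ → V)) : Prop :=
  Disjoint (A.winningRegion O 0) (A.winningRegion O 1) ∧
    A.winningRegion O 0 ∪ A.winningRegion O 1 = Set.univ

/-- The game `(A, O)` is pointwise memoryless for Player `i`. -/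
def IsPointwiseMemoryless {V U : Type*} (A : Arena V U) (O : Set (ℕ → V)) (i : Fin 2) : Prop :=
  A.memorylessWinningRegion O i = A.winningRegion O i

/-- The game `(A, O)` is uniform memoryless for Player `i`. -/
def IsUniformMemoryless {V U : Type*} (A : Arena V U) (O : Set (ℕ → V)) (i : Fin 2) : Prop :=
  ∃ S, A.IsStrategy i S ∧ A.IsMemoryless i S ∧ ∀ v ∈ A.winningRegion O i, A.IsWinningFrom O i S v

/-- The game `(A, O)` is pointwise memoryless determined. -/
def IsPointwiseMemorylessDetermined {V U : Type*} (A : Arena V U) (O : Set (ℕ → V)) : Prop :=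
  A.IsDetermined O ∧ ∀ i, A.IsPointwiseMemoryless O i

/-- The game `(A, O)` is uniform memoryless determined. -/
def IsUniformMemorylessDetermined {V U : Type*} (A : Arena V U) (O : Set (ℕ → V)) : Prop :=
  A.IsDetermined O ∧ ∀ i, A.IsUniformMemoryless O i

end Arena

/-! In the first-cycle game play stops at the first cycle popped, and Player `i` wants its labels in
`Z`. The winner from `v` can win forever: popping a cycle returns to an earlier pair (stack,
vertex), which was winning as well. So from each `v` either one player forces `allCycles Z` or the
other forces `allCycles Zᶜ` (`exists_stackForces_or`). On an unambiguous arena two such strategies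
cannot meet, not even on suffixes. Hence forcing `suffixAllCycles Z` already yields forcing
`allCycles Z`, and every vertex reached while forcing it can force it too. For memorylessness,
choices are fixed one vertex `z` at a time (`exists_prune`): follow any good strategy until `z` is
reached, then restart with a strategy depending on stack and vertex only. At each return to `z` the
restarted stack is empty, so the same edge is used at `z`. This forces the suffix objective, hence
the all-cycles objective, in the arena pruned at `z`. Pruning at all vertices leaves Player `i` a
single strategy, good from every vertex at once. In a greedy game these forcing regions are the
winning regions. -/

section Stack

/-! ### Invariants of the cycle-popping stack. -/

variable {V : Type*}

/-- The set `X` of pairs (stack, current vertex) contains the given pair and all the pairs below it,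
and the stack is a path that ends in the current vertex. -/
def StackInv (X : Set (List (V × V) × V)) : List (V × V) → V → Prop
  | [], v => ([], v) ∈ X
  | e :: st, v => (e :: st, v) ∈ X ∧ e.2 = v ∧ StackInv X st e.1

theorem StackInv.mem {X : Set (List (V × V) × V)} {st : List (V × V)} {v : V}
    (h : StackInv X st v) : (st, v) ∈ X := by
  cases st with
  | nil => exact h
  | cons e st => exact h.1

/-- The source of the deepest edge removed is the vertex where the remaining stack ends; the dummy
edge `(v, w)` covers `k = 0`. -/
theorem StackInv.drop {X : Set (List (V × V) × V)} {st : List (V × V)} {v : V} (w : V)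
    (h : StackInv X st v) (k : ℕ) :
    StackInv X (st.drop k) (((v, w) :: st.take k).getLast (List.cons_ne_nil _ _)).1 := by
  induction st generalizing v w k with
  | nil => simpa using h
  | cons e st ih =>
    cases k with
    | zero => simpa using h
    | succ k =>
      obtain ⟨a, b⟩ := e
      have := ih b h.2.2 k
      simpa [List.getLast_cons] using this

theorem StackInv.isChain {X : Set (List (V × V) × V)} {st : List (V × V)} {v : V} (w : V)
    (h : StackInv X st v) : List.IsChain (fun a b : V × V => b.2 = a.1) ((v, w) :: st) := by
  induction st generalizing v w with
  | nil => simp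
  | cons e st ih =>
    obtain ⟨a, b⟩ := e
    exact List.isChain_cons_cons.2 ⟨h.2.1, ih b h.2.2⟩

theorem isCycle_iff (l : List (V × V)) : IsCycle l ↔ ∃ h : l ≠ [],
    List.IsChain (fun a b : V × V => a.2 = b.1) l ∧ (l.getLast h).2 = (l.head h).1 := by
  cases l <;> simp [IsCycle]

theorem isCycle_reverse_cons_iff (e : V × V) (l : List (V × V)) : IsCycle (e :: l).reverse ↔
    List.IsChain (fun a b : V × V => b.2 = a.1) (e :: l) ∧
      e.2 = ((e :: l).getLast (List.cons_ne_nil _ _)).1 := by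
  rw [isCycle_iff]
  constructor
  · rintro ⟨h, h1, h2⟩
    refine ⟨List.isChain_reverse.1 h1, ?_⟩
    rw [List.getLast_reverse, List.head_reverse] at h2
    exact h2
  · rintro ⟨h1, h2⟩
    refine ⟨by simp, List.isChain_reverse.2 h1, ?_⟩
    rw [List.getLast_reverse, List.head_reverse]
    exact h2

theorem popCycle_of_none {st : List (V × V)} (h : (popCycle st).2 = none) :
    (popCycle st).1 = st ∧ ∀ k, ¬ IsCycle (st.take k).reverse := by
  unfold popCycle at h ⊢
  split_ifs at h ⊢ with hk
  exact ⟨rfl, not_exists.1 hk⟩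

theorem popCycle_of_some {st c : List (V × V)} (h : (popCycle st).2 = some c) :
    ∃ k, (popCycle st).1 = st.drop k ∧ IsCycle (st.take k).reverse := by
  classical
  unfold popCycle at h ⊢
  split_ifs at h ⊢ with hk
  exact ⟨_, rfl, Nat.find_spec hk⟩

/-- Moving from `v` to `w` with stack `st` either outputs a cycle in `C`, or leads to a pair
in `X`. -/
def StackStep (X : Set (List (V × V) × V)) (C : Set (List (V × V)))
    (st : List (V × V)) (v w : V) : Prop :=
  (∀ c, (popCycle ((v, w) :: st)).2 = some c → c ∈ C) ∧
    ((popCycle ((v, w) :: st)).2 = none → ((v, w) :: st, w) ∈ X)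

/-- If a cycle is popped, it closes at `w`, so the new pair is one that already lay below the old
stack. -/
theorem StackInv.step {X : Set (List (V × V) × V)} {C : Set (List (V × V))}
    {st : List (V × V)} {v w : V} (h : StackInv X st v) (hs : StackStep X C st v w) :
    StackInv X (popCycle ((v, w) :: st)).1 w := by
  rcases hc : (popCycle ((v, w) :: st)).2 with _ | c
  · rw [(popCycle_of_none hc).1]
    exact ⟨hs.2 hc, rfl, h⟩
  · obtain ⟨k, hk, hcyc⟩ := popCycle_of_some hc
    cases k with
    | zero => simp [IsCycle] at hcyc
    | succ k =>
      rw [List.take_succ_cons, isCycle_reverse_cons_iff] at hcyc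
      rw [hk, List.drop_succ_cons]
      have := h.drop w k
      rw [← hcyc.2] at this
      exact this

theorem stackInv_stackAt {X : Set (List (V × V) × V)} {C : Set (List (V × V))} {π : ℕ → V}
    (h0 : ([], π 0) ∈ X)
    (hs : ∀ j, StackInv X (stackAt π j) (π j) → StackStep X C (stackAt π j) (π j) (π (j + 1)))
    (j : ℕ) : StackInv X (stackAt π j) (π j) := by
  induction j with
  | zero => exact h0
  | succ j ih => exact ih.step (hs j ih)

theorem stackAt_eq_nil {π : ℕ → V} {j : ℕ} (h : π j = π 0) : stackAt π j = [] := by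
  -- The stack always starts at `π 0`, so on a return to `π 0` the whole stack with the new edge
  -- would be a cycle: something must be popped.
  have key := stackInv_stackAt (X := {p | p.1 = [] ↔ p.2 = π 0}) (C := Set.univ) (π := π)
    (by simp) (fun j hj => ⟨fun _ _ => Set.mem_univ _, fun hn => by
      have hbot := hj.drop (π (j + 1)) (stackAt π j).length
      rw [List.drop_length, List.take_length] at hbot
      have hlast := (hbot : _ ↔ _).1 rfl
      suffices π (j + 1) ≠ π 0 by simpa using this
      intro hw
      refine (popCycle_of_none hn).2 ((stackAt π j).length + 1) ?_
      rw [List.take_succ_cons, List.take_length, isCycle_reverse_cons_iff]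
      exact ⟨hj.isChain _, hw.trans hlast.symm⟩⟩) j
  exact (key.mem : _ ↔ _).2 h

theorem stackAt_congr {π ρ : ℕ → V} {n : ℕ} (h : ∀ k ≤ n, π k = ρ k) :
    stackAt π n = stackAt ρ n := by
  induction n with
  | zero => rfl
  | succ n ih =>
    simp only [stackAt]
    rw [ih fun k hk => h k (by omega), h n (by omega), h (n + 1) le_rfl]

/-! ### Plays and strategies from rules that look only at the past. -/

/-- The value of `g` at `π` and `n` depends on `π 0, …, π n` only. -/
def IsLocal (g : (ℕ → V) → ℕ → V) : Prop :=
  ∀ (π ρ : ℕ → V) (n : ℕ), (∀ k ≤ n, π k = ρ k) → g π n = g ρ n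

theorem IsLocal.exists_seq {g : (ℕ → V) → ℕ → V} (hg : IsLocal g) (v : V) :
    ∃ π : ℕ → V, π 0 = v ∧ ∀ n, π (n + 1) = g π n := by
  let h : ℕ → ℕ → V := fun n =>
    Nat.rec (fun _ => v) (fun n p => Function.update p (n + 1) (g p n)) n
  have hsucc : ∀ n, h (n + 1) = Function.update (h n) (n + 1) (g (h n) n) := fun n => rfl
  have hstable : ∀ n d, h (n + d) n = h n n := by
    intro n d
    induction d with
    | zero => rfl
    | succ d ih =>
      rw [← add_assoc, hsucc, Function.update_of_ne (by omega), ih]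
  refine ⟨fun n => h n n, rfl, fun n => ?_⟩
  show h (n + 1) (n + 1) = _
  rw [hsucc, Function.update_self]
  refine hg _ _ _ fun k hk => ?_
  obtain ⟨d, rfl⟩ := Nat.exists_eq_add_of_le hk
  exact hstable k d

theorem map_range_congr {π ρ : ℕ → V} {n : ℕ} (h : ∀ k < n, π k = ρ k) :
    (List.range n).map π = (List.range n).map ρ :=
  List.map_congr_left fun k hk => h k (List.mem_range.1 hk)

end Stack

namespace Arena

variable {V U : Type*}

/-- Player `i` has a strategy all of whose plays from `v` are in `P`. -/
def Forces (A : Arena V U) (i : Fin 2) (P : Set (ℕ → V)) (v : V) : Prop :=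
  ∃ S, A.IsStrategy i S ∧ ∀ π ∈ A.plays, π 0 = v → A.IsConsistent i S π → π ∈ P

theorem exists_strategy (A : Arena V U) (i : Fin 2) {g : (ℕ → V) → ℕ → V} (hg : IsLocal g)
    (hedge : ∀ π n, A.owner (π n) = i → A.edge (π n) (g π n)) :
    ∃ S, A.IsStrategy i S ∧ ∀ (π : ℕ → V) (n : ℕ), S ((List.range n).map π) (π n) = g π n := by
  -- The history is padded to an infinite sequence by repeating `v`; locality makes the padding
  -- irrelevant.
  refine ⟨fun u v => g (fun k => (u ++ [v]).getD k v) u.length, fun u v hv => ?_, fun π n => ?_⟩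
  · have := hedge (fun k => (u ++ [v]).getD k v) u.length
    simpa [hv] using this
  · simp only [List.length_map, List.length_range]
    refine hg _ _ _ fun k hk => ?_
    rcases hk.lt_or_eq with hk | rfl
    · simp [List.getElem?_append, hk]
    · simp

/-- The moves given by `f` as a function of the stack and the current vertex follow edges, and all
plays from `v` in which Player `i` makes these moves are in the all-cycles objective of `Z`. -/
def StackForces (A : Arena V U) (i : Fin 2) (Z : Set (List U)) (v : V)
    (f : List (V × V) → V → V) : Prop :=
  (∀ st v, A.edge v (f st v)) ∧ ∀ π ∈ A.plays, π 0 = v →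
    (∀ n, A.owner (π n) = i → π (n + 1) = f (stackAt π n) (π n)) → π ∈ A.allCycles Z

theorem StackForces.forces {A : Arena V U} {i : Fin 2} {Z : Set (List U)} {v : V}
    {f : List (V × V) → V → V} (h : A.StackForces i Z v f) : A.Forces i (A.allCycles Z) v := by
  obtain ⟨S, hS, hSf⟩ := A.exists_strategy i (g := fun π n => f (stackAt π n) (π n))
    (fun π ρ n hk => by simp only [stackAt_congr hk, hk n le_rfl]) (fun π n _ => h.1 _ _)
  refine ⟨S, hS, fun π hπ h0 hc => h.2 π hπ h0 fun n hn => ?_⟩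
  rw [hc n hn, hSf]

/-- If Player `i` can keep the pairs (stack, current vertex) in `X` until a cycle is output, which
is then in `Z`, then Player `i` can do so forever. -/
theorem exists_stackForces_of_mem (A : Arena V U) (i : Fin 2) (Z : Set (List U))
    (X : Set (List (V × V) × V))
    (hown : ∀ st v, (st, v) ∈ X → A.owner v = i →
      ∃ w, A.edge v w ∧ StackStep X {c | A.labels c ∈ Z} st v w)
    (hopp : ∀ st v, (st, v) ∈ X → A.owner v ≠ i →
      ∀ w, A.edge v w → StackStep X {c | A.labels c ∈ Z} st v w)
    (v : V) (hv : ([], v) ∈ X) : ∃ f, A.StackForces i Z v f := by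
  have hf : ∀ (st : List (V × V)) (v : V), ∃ w, A.edge v w ∧
      ((st, v) ∈ X → A.owner v = i → StackStep X {c | A.labels c ∈ Z} st v w) := by
    intro st v
    by_cases h : (st, v) ∈ X ∧ A.owner v = i
    · obtain ⟨w, hw, hs⟩ := hown st v h.1 h.2
      exact ⟨w, hw, fun _ _ => hs⟩
    · obtain ⟨w, hw⟩ := A.noDeadEnd v
      exact ⟨w, hw, fun h1 h2 => absurd ⟨h1, h2⟩ h⟩
  choose f hfe hfs using hf
  refine ⟨f, hfe, fun π hπ h0 hc => ?_⟩
  have hstep : ∀ j, StackInv X (stackAt π j) (π j) →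
      StackStep X {c | A.labels c ∈ Z} (stackAt π j) (π j) (π (j + 1)) := by
    intro j hj
    by_cases ho : A.owner (π j) = i
    · rw [hc j ho]
      exact hfs _ _ hj.mem ho
    · exact hopp _ _ hj.mem ho _ (hπ j)
  refine ⟨hπ, ?_⟩
  rintro u ⟨j, hj⟩
  exact (hstep j (stackInv_stackAt (h0 ▸ hv) hstep j)).1 u hj

/-! ### Determinacy via the first-cycle game. -/

/-- Player `i` wins the first-cycle game of `Z` from the given stack and current vertex. -/
inductive WinsFirstCycle (A : Arena V U) (i : Fin 2) (Z : Set (List U)) : List (V × V) → V → Prop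
  | own (st : List (V × V)) (v w : V) (hv : A.owner v = i) (hw : A.edge v w)
      (hc : ∀ c, (popCycle ((v, w) :: st)).2 = some c → A.labels c ∈ Z)
      (hn : (popCycle ((v, w) :: st)).2 = none → WinsFirstCycle A i Z ((v, w) :: st) w) :
      WinsFirstCycle A i Z st v
  | opp (st : List (V × V)) (v : V) (hv : A.owner v ≠ i)
      (hc : ∀ w, A.edge v w → ∀ c, (popCycle ((v, w) :: st)).2 = some c → A.labels c ∈ Z)
      (hn : ∀ w, A.edge v w → (popCycle ((v, w) :: st)).2 = none →
        WinsFirstCycle A i Z ((v, w) :: st) w) :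
      WinsFirstCycle A i Z st v

/-- `WinsFirstCycle` is a least fixed point, so its complement is a region in which the opponent can
stay. A play with no cycle output satisfies either objective vacuously. -/
theorem exists_stackForces_or (A : Arena V U) {i j : Fin 2} (hij : i ≠ j) (Z : Set (List U))
    (v : V) : (∃ f, A.StackForces i Z v f) ∨ ∃ f, A.StackForces j Zᶜ v f := by
  have hji : ∀ {k : Fin 2}, k = j ↔ k ≠ i := by omega
  by_cases h : A.WinsFirstCycle i Z [] v
  · refine Or.inl (A.exists_stackForces_of_mem i Z {p | A.WinsFirstCycle i Z p.1 p.2} ?_ ?_ v h)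
    · rintro st v h hv
      cases h with
      | own _ _ w hv hw hc hn => exact ⟨w, hw, hc, hn⟩
      | opp _ _ hv' => exact absurd hv hv'
    · rintro st v h hv w hw
      cases h with
      | own _ _ w hv' => exact absurd hv' hv
      | opp _ _ hv hc hn => exact ⟨hc w hw, hn w hw⟩
  · have hstep : ∀ st v w, ¬ StackStep {p | A.WinsFirstCycle i Z p.1 p.2}
        {c | A.labels c ∈ Z} st v w → StackStep {p | ¬ A.WinsFirstCycle i Z p.1 p.2}
        {c | A.labels c ∈ Zᶜ} st v w := by
      intro st v w hs
      refine ⟨fun c hc hcZ => hs ⟨fun c' hc' => ?_, fun hn => ?_⟩,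
        fun hn hw => hs ⟨fun c hc => ?_, fun _ => hw⟩⟩
      · rw [hc] at hc'
        cases hc'
        exact hcZ
      · rw [hc] at hn
        cases hn
      · rw [hn] at hc
        cases hc
    refine Or.inr (A.exists_stackForces_of_mem j Zᶜ {p | ¬ A.WinsFirstCycle i Z p.1 p.2}
      ?_ ?_ v h)
    · intro st v h hv
      by_contra! hne
      refine h (.opp st v (hji.1 hv) (fun w hw => ?_) (fun w hw => ?_))
      · exact (not_not.1 fun hs => hne w hw (hstep _ _ _ hs)).1
      · exact (not_not.1 fun hs => hne w hw (hstep _ _ _ hs)).2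
    · intro st v h hv w hw
      refine hstep _ _ _ fun hs => h (.own st v w ?_ hw hs.1 hs.2)
      by_contra hi
      exact hv (hji.2 hi)

/-! ### Playing strategies against each other; consequences of unambiguity. -/

/-- A finite path that is consistent with `S` can be continued to a play that is consistent with
`S`, and whose suffix from the end of that path is consistent with `T`. -/
theorem exists_play (A : Arena V U) {i j : Fin 2} (hij : i ≠ j) {S T : List V → V → V}
    (hS : A.IsStrategy i S) (hT : A.IsStrategy j T) (π : ℕ → V) (n : ℕ)
    (hπ : ∀ k < n, A.edge (π k) (π (k + 1)))
    (hc : ∀ k < n, A.owner (π k) = i → π (k + 1) = S ((List.range k).map π) (π k)) :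
    ∃ ρ ∈ A.plays, ρ 0 = π 0 ∧ ρ n = π n ∧ A.IsConsistent i S ρ ∧
      A.IsConsistent j T (fun k => ρ (n + k)) := by
  classical
  have hji : ∀ {k : Fin 2}, k = j ↔ k ≠ i := by omega
  have hloc : IsLocal (fun (ρ : ℕ → V) k => if k < n then π (k + 1) else
      if A.owner (ρ k) = i then S ((List.range k).map ρ) (ρ k) else
        T ((List.range (k - n)).map fun l => ρ (n + l)) (ρ k)) := by
    intro ρ σ k h
    have h1 : (List.range k).map ρ = (List.range k).map σ :=
      map_range_congr fun l hl => h l hl.le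
    by_cases hk : k < n
    · simp only [hk, if_true]
    · have h2 : (List.range (k - n)).map (fun l => ρ (n + l)) =
          (List.range (k - n)).map fun l => σ (n + l) :=
        map_range_congr fun l hl => h (n + l) (by omega)
      simp only [hk, if_false, h1, h2, h k le_rfl]
  obtain ⟨ρ, hρ0, hρ⟩ := hloc.exists_seq (π 0)
  have heq : ∀ k ≤ n, ρ k = π k := by
    intro k hk
    cases k with
    | zero => exact hρ0
    | succ k => rw [hρ k, if_pos (by omega)]
  refine ⟨ρ, fun k => ?_, hρ0, heq n le_rfl, fun k hk => ?_, fun k hk => ?_⟩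
  · by_cases hk : k < n
    · rw [heq k hk.le, heq (k + 1) hk]
      exact hπ k hk
    · rw [hρ k, if_neg hk]
      split_ifs with ho
      · exact hS _ _ ho
      · exact hT _ _ (hji.2 ho)
  · by_cases hkn : k < n
    · rw [heq (k + 1) hkn, heq k hkn.le, map_range_congr fun l hl => heq l (by omega)]
      exact hc k hkn (heq k hkn.le ▸ hk)
    · rw [hρ k, if_neg hkn, if_pos hk]
  · show ρ (n + k + 1) = _
    rw [hρ (n + k), if_neg (by omega), if_neg (hji.1 hk), Nat.add_sub_cancel_left]

theorem Forces.exists_play {A : Arena V U} {i j : Fin 2} (hij : i ≠ j) {P Q : Set (ℕ → V)} {v : V}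
    (hP : A.Forces i P v) (hQ : A.Forces j Q v) : ∃ π ∈ A.plays, π ∈ P ∧ π ∈ Q := by
  obtain ⟨S, hS, hSP⟩ := hP
  obtain ⟨T, hT, hTQ⟩ := hQ
  obtain ⟨ρ, hρ, h0, -, h1, h2⟩ := A.exists_play hij hS hT (fun _ => v) 0
    (fun k hk => absurd hk (Nat.not_lt_zero k)) (fun k hk => absurd hk (Nat.not_lt_zero k))
  simp only [Nat.zero_add] at h2
  exact ⟨ρ, hρ, hSP ρ hρ h0 h1, hTQ ρ hρ h0 h2⟩

theorem Forces.mono {A : Arena V U} {i : Fin 2} {P Q : Set (ℕ → V)} {v : V}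
    (h : A.Forces i P v) (hPQ : P ⊆ Q) : A.Forces i Q v := by
  obtain ⟨S, hS, hSP⟩ := h
  exact ⟨S, hS, fun π hπ h0 hc => hPQ (hSP π hπ h0 hc)⟩

theorem allCycles_subset_suffixAllCycles (A : Arena V U) (Z : Set (List U)) :
    A.allCycles Z ⊆ A.suffixAllCycles Z :=
  fun π hπ => ⟨hπ.1, 0, by simpa using hπ.2⟩

theorem mem_suffixAllCycles_of_shift {A : Arena V U} {Z : Set (List U)} {π : ℕ → V}
    (hπ : π ∈ A.plays) (n : ℕ) (h : (fun k => π (n + k)) ∈ A.allCycles Z) :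
    π ∈ A.suffixAllCycles Z :=
  ⟨hπ, n, h.2⟩

theorem shift_mem_plays {A : Arena V U} {π : ℕ → V} (hπ : π ∈ A.plays) (n : ℕ) :
    (fun k => π (n + k)) ∈ A.plays :=
  fun k => hπ (n + k)

theorem IsUnambiguous.compl {A : Arena V U} {Y : Set (List U)} (h : A.IsUnambiguous Y) :
    A.IsUnambiguous Yᶜ := by
  unfold IsUnambiguous at h ⊢
  rwa [compl_compl, Set.inter_comm]

theorem IsUnambiguous.false {A : Arena V U} {Y : Set (List U)} (h : A.IsUnambiguous Y)
    {π : ℕ → V} (h1 : π ∈ A.suffixAllCycles Y) (h2 : π ∈ A.suffixAllCycles Yᶜ) : False := by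
  have : π ∈ A.suffixAllCycles Y ∩ A.suffixAllCycles Yᶜ := ⟨h1, h2⟩
  rw [h] at this
  exact this

/-- Otherwise the opponent forces `allCycles Zᶜ`, and the two strategies together produce an
ambiguous play. -/
theorem IsUnambiguous.exists_stackForces {A : Arena V U} {Z : Set (List U)}
    (h : A.IsUnambiguous Z) {i : Fin 2} {v : V} (hv : A.Forces i (A.suffixAllCycles Z) v) :
    ∃ f, A.StackForces i Z v f := by
  obtain ⟨j, hij⟩ := exists_ne i
  refine (A.exists_stackForces_or hij.symm Z v).resolve_right ?_
  rintro ⟨f, hf⟩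
  obtain ⟨π, -, h1, h2⟩ := hv.exists_play hij.symm hf.forces
  exact h.false h1 (A.allCycles_subset_suffixAllCycles _ h2)

/-- A vertex that is reached by a strategy that forces the all-cycles objective is winning. -/
theorem IsUnambiguous.exists_stackForces_of_path {A : Arena V U} {Z : Set (List U)}
    (h : A.IsUnambiguous Z) {i : Fin 2} {v : V} {S : List V → V → V} (hS : A.IsStrategy i S)
    (hSv : ∀ π ∈ A.plays, π 0 = v → A.IsConsistent i S π → π ∈ A.allCycles Z)
    (π : ℕ → V) (n : ℕ) (h0 : π 0 = v) (hπ : ∀ k < n, A.edge (π k) (π (k + 1)))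
    (hc : ∀ k < n, A.owner (π k) = i → π (k + 1) = S ((List.range k).map π) (π k)) :
    ∃ f, A.StackForces i Z (π n) f := by
  obtain ⟨j, hij⟩ := exists_ne i
  refine (A.exists_stackForces_or hij.symm Z (π n)).resolve_right ?_
  rintro ⟨f, hf⟩
  obtain ⟨T, hT, hTv⟩ := hf.forces
  obtain ⟨ρ, hρ, hρ0, hρn, h1, h2⟩ := A.exists_play hij.symm hS hT π n hπ hc
  exact h.false (A.allCycles_subset_suffixAllCycles _ (hSv ρ hρ (hρ0.trans h0) h1))
    (mem_suffixAllCycles_of_shift hρ n (hTv _ (shift_mem_plays hρ n) hρn h2))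

/-! ### Memoryless strategies by pruning. -/

/-- The arena in which all edges from `z` other than the one to `e` are deleted. -/
def prune (A : Arena V U) (z e : V) (he : A.edge z e) : Arena V U where
  owner := A.owner
  edge v w := A.edge v w ∧ (v = z → w = e)
  noDeadEnd v := by
    by_cases hv : v = z
    · exact ⟨e, hv ▸ he, fun _ => rfl⟩
    · obtain ⟨w, hw⟩ := A.noDeadEnd v
      exact ⟨w, hw, fun h => absurd h hv⟩
  label := A.label

theorem plays_prune_subset (A : Arena V U) {z e : V} (he : A.edge z e) :
    (A.prune z e he).plays ⊆ A.plays :=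
  fun _ hπ j => (hπ j).1

theorem suffixAllCycles_prune_subset (A : Arena V U) {z e : V} (he : A.edge z e)
    (Z : Set (List U)) : (A.prune z e he).suffixAllCycles Z ⊆ A.suffixAllCycles Z :=
  fun _ hπ => ⟨A.plays_prune_subset he hπ.1, hπ.2⟩

theorem IsUnambiguous.prune {A : Arena V U} {Z : Set (List U)} (h : A.IsUnambiguous Z) {z e : V}
    (he : A.edge z e) : (A.prune z e he).IsUnambiguous Z :=
  Set.eq_empty_of_forall_notMem fun _ hπ =>
    h.false (A.suffixAllCycles_prune_subset he _ hπ.1) (A.suffixAllCycles_prune_subset he _ hπ.2)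

/-- Player `i` can commit to a single edge at the vertex `z`, and still win from the same
vertices. -/
theorem IsUnambiguous.exists_prune {A : Arena V U} {Z : Set (List U)} (h : A.IsUnambiguous Z)
    (i : Fin 2) (z : V) : ∃ (e : V) (he : A.edge z e), ∀ v, A.Forces i (A.allCycles Z) v →
      (A.prune z e he).Forces i ((A.prune z e he).allCycles Z) v := by
  classical
  -- If nothing can be forced from `z`, any edges will do: the good plays then avoid `z`.
  obtain ⟨f, hf, hfz⟩ : ∃ f : List (V × V) → V → V, (∀ st v, A.edge v (f st v)) ∧
      ((∃ f, A.StackForces i Z z f) → A.StackForces i Z z f) := by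
    by_cases hz : ∃ f, A.StackForces i Z z f
    · obtain ⟨f, hf⟩ := hz
      exact ⟨f, hf.1, fun _ => hf⟩
    · choose f hf using A.noDeadEnd
      exact ⟨fun _ => f, fun _ => hf, fun h => absurd h hz⟩
  refine ⟨f [] z, hf [] z, fun v hv => ?_⟩
  obtain ⟨S, hS, hSv⟩ := hv
  suffices hE : (A.prune z (f [] z) (hf [] z)).Forces i
      ((A.prune z (f [] z) (hf [] z)).suffixAllCycles Z) v by
    obtain ⟨f', hf'⟩ := (h.prune (hf [] z)).exists_stackForces hE
    exact hf'.forces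
  -- Follow `S` before the first visit to `z`, then use `f` with a stack started at that visit.
  let g : (ℕ → V) → ℕ → V := fun π n =>
    if hz : ∃ k, k ≤ n ∧ π k = z then
      f (stackAt (fun l => π (Nat.find hz + l)) (n - Nat.find hz)) (π n)
    else S ((List.range n).map π) (π n)
  have hgpos : ∀ (π : ℕ → V) (m n : ℕ), m ≤ n → π m = z → (∀ k < m, π k ≠ z) →
      g π n = f (stackAt (fun l => π (m + l)) (n - m)) (π n) := by
    intro π m n hmn hm hlt
    have hz : ∃ k, k ≤ n ∧ π k = z := ⟨m, hmn, hm⟩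
    have hfind : Nat.find hz = m :=
      (Nat.find_eq_iff hz).2 ⟨⟨hmn, hm⟩, fun k hk hk' => hlt k hk hk'.2⟩
    simp only [g, dif_pos hz, hfind]
  have hgneg : ∀ (π : ℕ → V) (n : ℕ), (∀ k ≤ n, π k ≠ z) →
      g π n = S ((List.range n).map π) (π n) := by
    intro π n hn
    simp only [g]
    rw [dif_neg]
    rintro ⟨k, hk, hkz⟩
    exact hn k hk hkz
  have hfirst : ∀ (π : ℕ → V) (n : ℕ), (∃ k, k ≤ n ∧ π k = z) →
      ∃ m ≤ n, π m = z ∧ ∀ k < m, π k ≠ z := by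
    intro π n hz
    exact ⟨Nat.find hz, (Nat.find_spec hz).1, (Nat.find_spec hz).2, fun k hk hkz =>
      Nat.find_min hz hk ⟨hk.le.trans (Nat.find_spec hz).1, hkz⟩⟩
  have hg : IsLocal g := by
    intro π ρ n hk
    by_cases hz : ∃ k, k ≤ n ∧ π k = z
    · obtain ⟨m, hmn, hm, hlt⟩ := hfirst π n hz
      rw [hgpos π m n hmn hm hlt, hgpos ρ m n hmn (hk m hmn ▸ hm)
        (fun k hkm => hk k (by omega) ▸ hlt k hkm), hk n le_rfl,
        stackAt_congr fun l hl => hk (m + l) (by omega)]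
    · push Not at hz
      rw [hgneg π n hz, hgneg ρ n fun k hkn => hk k hkn ▸ hz k hkn, hk n le_rfl,
        map_range_congr fun l hl => hk l hl.le]
  have hedge : ∀ π n, A.owner (π n) = i →
      (A.prune z (f [] z) (hf [] z)).edge (π n) (g π n) := by
    intro π n ho
    by_cases hz : ∃ k, k ≤ n ∧ π k = z
    · obtain ⟨m, hmn, hm, hlt⟩ := hfirst π n hz
      rw [hgpos π m n hmn hm hlt]
      refine ⟨hf _ _, fun hn => ?_⟩
      -- Back at `z`, the restarted stack is empty, so the move is the retained edge.
      rw [stackAt_eq_nil, hn]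
      simp [hm, hn, Nat.add_sub_cancel' hmn]
    · push Not at hz
      rw [hgneg π n hz]
      exact ⟨hS _ _ ho, fun hn => absurd hn (hz n le_rfl)⟩
  obtain ⟨S', hS', hSg⟩ := (A.prune z (f [] z) (hf [] z)).exists_strategy i hg hedge
  refine ⟨S', hS', fun π hπ h0 hc => ?_⟩
  have hπA := A.plays_prune_subset _ hπ
  have hcg : ∀ n, A.owner (π n) = i → π (n + 1) = g π n :=
    fun n hn => (hc n hn).trans (hSg π n)
  refine ⟨hπ, ?_⟩
  by_cases hz : ∃ k, π k = z
  · obtain ⟨n, hn⟩ := hz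
    obtain ⟨m, -, hm, hlt⟩ := hfirst π n ⟨n, le_rfl, hn⟩
    have hfm : ∃ f, A.StackForces i Z (π m) f :=
      h.exists_stackForces_of_path hS hSv π m h0 (fun k _ => hπA k) fun k hk ho => by
        rw [hcg k ho, hgneg π k fun l hl => hlt l (by omega)]
    rw [hm] at hfm
    refine ⟨m, ((hfz hfm).2 _ (shift_mem_plays hπA m) hm fun k ho => ?_).2⟩
    show π (m + k + 1) = _
    rw [hcg (m + k) ho, hgpos π m (m + k) (by omega) hm hlt, Nat.add_sub_cancel_left]
  · push Not at hz
    refine (A.allCycles_subset_suffixAllCycles Z (hSv π hπA h0 fun k ho => ?_)).2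
    rw [hcg k ho, hgneg π k fun l _ => hz l]

/-- `B` is obtained from `A` by deleting edges of Player `i`, and Player `i` still forces the
all-cycles objective of `Z` from the same vertices. -/
structure IsRestriction (A B : Arena V U) (i : Fin 2) (Z : Set (List U)) : Prop where
  owner_eq : B.owner = A.owner
  label_eq : B.label = A.label
  edge_of_edge : ∀ v w, B.edge v w → A.edge v w
  edge_of_owner_ne : ∀ v w, A.owner v ≠ i → A.edge v w → B.edge v w
  unambiguous : B.IsUnambiguous Z
  forces : ∀ v, A.Forces i (A.allCycles Z) v → B.Forces i (B.allCycles Z) v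

theorem IsUnambiguous.exists_isRestriction {A : Arena V U} {Z : Set (List U)}
    (h : A.IsUnambiguous Z) (i : Fin 2) (F : Finset V) :
    ∃ B, A.IsRestriction B i Z ∧ ∀ z ∈ F, A.owner z = i → ∃ e, ∀ w, B.edge z w → w = e := by
  classical
  induction F using Finset.induction_on with
  | empty => exact ⟨A, ⟨rfl, rfl, fun _ _ => id, fun _ _ _ => id, h, fun _ => id⟩, by simp⟩
  | insert z F _ ih =>
    obtain ⟨B, hB, hF⟩ := ih
    by_cases hz : A.owner z = i
    · obtain ⟨e, he, hforces⟩ := hB.unambiguous.exists_prune i z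
      refine ⟨B.prune z e he, ⟨hB.owner_eq, hB.label_eq, fun v w hvw => hB.edge_of_edge v w hvw.1,
        fun v w hv hvw => ⟨hB.edge_of_owner_ne v w hv hvw, fun hvz => absurd (hvz ▸ hz) hv⟩,
        hB.unambiguous.prune he, fun v hv => hforces v (hB.forces v hv)⟩, fun x hx ho => ?_⟩
      rcases Finset.mem_insert.1 hx with rfl | hx
      · exact ⟨e, fun w hw => hw.2 rfl⟩
      · obtain ⟨e', he'⟩ := hF x hx ho
        exact ⟨e', fun w hw => he' w hw.1⟩
    · refine ⟨B, hB, fun x hx ho => ?_⟩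
      rcases Finset.mem_insert.1 hx with rfl | hx
      · exact absurd ho hz
      · exact hF x hx ho

/-- On an unambiguous arena a single memoryless strategy forces the all-cycles objective wherever it
can be forced. -/
theorem IsUnambiguous.exists_memoryless [Finite V] {A : Arena V U} {Z : Set (List U)}
    (h : A.IsUnambiguous Z) (i : Fin 2) : ∃ S, A.IsStrategy i S ∧ A.IsMemoryless i S ∧
      ∀ v, A.Forces i (A.allCycles Z) v →
        ∀ π ∈ A.plays, π 0 = v → A.IsConsistent i S π → π ∈ A.allCycles Z := by
  have := Fintype.ofFinite V
  obtain ⟨B, hB, huniq⟩ := h.exists_isRestriction i Finset.univ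
  choose m hm using B.noDeadEnd
  refine ⟨fun _ v => m v, fun _ v _ => hB.edge_of_edge _ _ (hm v), fun _ _ _ _ => rfl,
    fun v hv π hπ h0 hc => ?_⟩
  obtain ⟨S, hS, hSv⟩ := hB.forces v hv
  have hπB : π ∈ B.plays := by
    intro j
    by_cases ho : A.owner (π j) = i
    · rw [hc j ho]
      exact hm _
    · exact hB.edge_of_owner_ne _ _ ho (hπ j)
  refine ⟨hπ, fun u hu => ?_⟩
  have hlab := (hSv π hπB h0 fun j ho => ?_).2 u hu
  · unfold labels at hlab ⊢
    rwa [hB.label_eq] at hlab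
  -- With one edge left in `B`, `S` must agree with `m`, whatever `v` it was chosen for.
  · obtain ⟨e, he⟩ := huniq (π j) (Finset.mem_univ _) (hB.owner_eq ▸ ho)
    rw [he _ (hπB j), he _ (hS _ _ ho)]

/-! ### Determinacy of greedy games. -/

theorem disjoint_winningRegion (A : Arena V U) (O : Set (ℕ → V)) :
    Disjoint (A.winningRegion O 0) (A.winningRegion O 1) := by
  refine Set.disjoint_left.2 fun v h0 h1 => ?_
  obtain ⟨π, -, hP, hQ⟩ := Forces.exists_play (A := A) (v := v) zero_ne_one
    (P := {π | WonBy O 0 π}) (Q := {π | WonBy O 1 π}) h0 h1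
  simp only [WonBy, Set.mem_ofPred_eq, if_true, one_ne_zero, if_false] at hP hQ
  exact hQ hP

theorem IsGreedy.isUniformMemorylessDetermined [Finite V] {A : Arena V U} {Y : Set (List U)}
    (hA : A.IsUnambiguous Y) {O : Set (ℕ → V)} (hO : A.IsGreedy Y O) :
    A.IsUniformMemorylessDetermined O := by
  have hcover : ∀ v, A.Forces 0 (A.allCycles Y) v ∨ A.Forces 1 (A.allCycles Yᶜ) v := fun v =>
    (A.exists_stackForces_or zero_ne_one Y v).imp (fun ⟨_, hf⟩ => hf.forces)
      fun ⟨_, hf⟩ => hf.forces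
  have hsub0 : A.allCycles Y ⊆ {π | WonBy O 0 π} := fun π hπ => by
    simpa [WonBy] using hO.1 hπ
  have hsub1 : A.allCycles Yᶜ ⊆ {π | WonBy O 1 π} := fun π hπ => by
    simpa [WonBy] using hO.2 hπ
  have hwin0 : ∀ v, A.Forces 0 (A.allCycles Y) v → v ∈ A.winningRegion O 0 :=
    fun v hv => hv.mono hsub0
  have hwin1 : ∀ v, A.Forces 1 (A.allCycles Yᶜ) v → v ∈ A.winningRegion O 1 :=
    fun v hv => hv.mono hsub1
  have hdisj := Set.disjoint_left.1 (A.disjoint_winningRegion O)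
  refine ⟨⟨A.disjoint_winningRegion O, Set.eq_univ_of_forall fun v =>
    (hcover v).imp (hwin0 v) (hwin1 v)⟩, ?_⟩
  rw [Fin.forall_fin_two]
  constructor
  · obtain ⟨S, hS, hSm, hSv⟩ := hA.exists_memoryless 0
    refine ⟨S, hS, hSm, fun v hv π hπ h0 hc => hsub0 (hSv v ?_ π hπ h0 hc)⟩
    -- A vertex won by Player 0 cannot be in the opponent's forcing region, so `allCycles Y` itself
    -- can be forced from it.
    exact (hcover v).resolve_right fun h => hdisj hv (hwin1 v h)
  · obtain ⟨S, hS, hSm, hSv⟩ := hA.compl.exists_memoryless 1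
    refine ⟨S, hS, hSm, fun v hv π hπ h0 hc => hsub1 (hSv v ?_ π hπ h0 hc)⟩
    exact (hcover v).resolve_left fun h => hdisj (hwin0 v h) hv

theorem IsUniformMemorylessDetermined.isPointwiseMemorylessDetermined {A : Arena V U}
    {O : Set (ℕ → V)} (h : A.IsUniformMemorylessDetermined O) :
    A.IsPointwiseMemorylessDetermined O := by
  refine ⟨h.1, fun i => Set.Subset.antisymm ?_ ?_⟩
  · rintro v ⟨S, hS, -, hv⟩
    exact ⟨S, hS, hv⟩
  · obtain ⟨S, hS, hSm, hSv⟩ := h.2 i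
    exact fun v hv => ⟨S, hS, hSm, hSv v hv⟩

theorem IsUnambiguous.isGreedy_suffixAllCycles {A : Arena V U} {Y : Set (List U)}
    (hA : A.IsUnambiguous Y) : A.IsGreedy Y (A.suffixAllCycles Y) :=
  ⟨A.allCycles_subset_suffixAllCycles Y, fun _ hπ hπ' =>
    hA.false hπ' (A.allCycles_subset_suffixAllCycles _ hπ)⟩

theorem IsUnambiguous.isGreedy_allCycles {A : Arena V U} {Y : Set (List U)}
    (hA : A.IsUnambiguous Y) : A.IsGreedy Y (A.allCycles Y) :=
  ⟨subset_rfl, fun _ hπ hπ' => hA.false (A.allCycles_subset_suffixAllCycles _ hπ')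
    (A.allCycles_subset_suffixAllCycles _ hπ)⟩

end Arena

theorem mainTheorem5 {V U : Type*} [Finite V] [Nonempty V] (A : Arena V U) (Y : Set (List U))
    (hA : A.IsUnambiguous Y) :
    ((∀ O : Set (ℕ → V), O ⊆ A.plays → A.IsGreedy Y O → A.IsPointwiseMemorylessDetermined O) ∧
      A.IsPointwiseMemorylessDetermined (A.suffixAllCycles Y) ∧
      A.IsPointwiseMemorylessDetermined (A.allCycles Y)) ∧
    (ClosedUnderCyclicPermutations Y →
      (∀ O : Set (ℕ → V), O ⊆ A.plays → A.IsGreedy Y O → A.IsUniformMemorylessDetermined O) ∧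
      A.IsUniformMemorylessDetermined (A.suffixAllCycles Y) ∧
      A.IsUniformMemorylessDetermined (A.allCycles Y)) := by
  have huniform : ∀ O : Set (ℕ → V), A.IsGreedy Y O → A.IsUniformMemorylessDetermined O :=
    fun O hO => hO.isUniformMemorylessDetermined hA
  exact ⟨⟨fun O _ hO => (huniform O hO).isPointwiseMemorylessDetermined,
    (huniform _ hA.isGreedy_suffixAllCycles).isPointwiseMemorylessDetermined,
    (huniform _ hA.isGreedy_allCycles).isPointwiseMemorylessDetermined⟩,
    fun _ => ⟨fun O _ hO => huniform O hO, huniform _ hA.isGreedy_suffixAllCycles,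
      huniform _ hA.isGreedy_allCycles⟩⟩
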